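/- Let $n\ge 1$ and let $X\subseteq\mathbb Z^n$ be finite and non-empty. For $x\in X$ let $F(x)=\{c\in\mathbb R^n : c^\top x\ge c^\top y\ \text{for all } y\in X\}$ be the cone of cost vectors for which $x$ maximizes $c^\top x$ over $X$. Call the cones of two distinct points $x,\tilde x\in X$ adjacent if $\dim(F(x)\cap F(\tilde x))>0$, and let $M=M(X)$ be the maximum of $\|x-\tilde x\|_\infty$ over all pairs of distinct $x,\tilde x\in X$ with adjacent cones ($M=1$ if there is no such pair). A ternary linear decision tree (LDT) is a finite rooted tree in which every inner node carries a test $a^\top c+b\odot 0$ ($a\in\mathbb R^n$, $b\in\mathbb R$) and has one child for each outcome $\odot\in\{<,=,>\}$, and in which every leaf carries an output; its depth is the largest number of tests on a path from the root to a leaf. A query $c\in\mathbb R^n$ follows the outcomes of the tests to a leaf, and its arithmetic operations are those needed to perform the tests on its path, each test costing $n$ multiplications, $n$ additions and one comparison. (1) There is an absolute constant $C$ such that for every $n\ge1$ and every finite non-empty $X\subseteq\mathbb Z^n$ there is a ternary LDT of depth at most $$2n^4\log_2 n+2n^4\log_2 M(X)+C\,n^3$$ that outputs, for every $c\in\mathbb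 R^n$, the set $\{x\in X : c\in F(x)\}$ of all optimal solutions of $\max_{x\in X}c^\top x$. (2) For every polynomial $p$ with coefficients in $\mathbb N$ there is a polynomial $q$ with coefficients in $\mathbb N$ such that, for every $n\ge1$ and every finite non-empty $X\subseteq\mathbb Z^n$ all of whose elements have binary encodings of at most $p(n)$ bits (for each entry, one sign bit and the binary digits of its absolute value), there is a policy $\pi:\mathbb R^n\to X$, with $\pi(c)$ an optimal solution of $\max_{x\in X}c^\top x$ for every $c$, that is represented by a ternary LDT in which every query takes at most $q(n)$ arithmetic operations. (3) If $\emptyset\ne X\subseteq\{0,1\}^n$ with $n\ge 1$, then $M(X)=1$. Consequently there are an absolute constant $C$ and a polynomial $q$ with coefficients in $\mathbb N$ such that, for every $n\ge1$ and every such $X$, there is a ternary LDT of depth at most $2n^4\log_2 n+C\,n^3$ that outputs the set of all optimal solutions for every $c\in\mathbb R^n$, and there is an optimal policy $\pi:\mathbb R^n\to X$ represented by a ternary LDT in which every query takes at most $q(n)$ arithmetic operations. -/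

import Mathlib

/-! ### Ternary linear decision trees -/

/-- A ternary linear decision tree on inputs `c ∈ ℝⁿ` with outputs in `α`. An inner node carries a
linear test `aᵀc + b ⊙ 0` and three children, one for each outcome `<`, `=`, `>`. -/
inductive TernaryLDT (n : ℕ) (α : Type) : Type
  | leaf (out : α) : TernaryLDT n α
  | node (a : Fin n → ℝ) (b : ℝ) (lt eq gt : TernaryLDT n α) : TernaryLDT n α

namespace TernaryLDT

/-- The depth of a tree: the maximal number of tests on a path from the root to a leaf. -/
def depth {n : ℕ} {α : Type} : TernaryLDT n α → ℕ
  | leaf _ => 0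
  | node _ _ lt eq gt => max lt.depth (max eq.depth gt.depth) + 1

open Classical in
/-- The output at the leaf reached by the input `c`. -/
noncomputable def eval {n : ℕ} {α : Type} : TernaryLDT n α → (Fin n → ℝ) → α
  | leaf out, _ => out
  | node a b lt eq gt, c =>
      if a ⬝ᵥ c + b < 0 then lt.eval c
      else if a ⬝ᵥ c + b = 0 then eq.eval c
      else gt.eval c

open Classical in
/-- The number of arithmetic operations of the query `c`: every test met on the path of `c` costs
`n` multiplications and `n` additions, to compute `aᵀc + b`, and one comparison with `0`. -/
noncomputable def queryOps {n : ℕ} {α : Type} : TernaryLDT n α → (Fin n → ℝ) → ℕ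
  | leaf _, _ => 0
  | node a b lt eq gt, c =>
      (n + n + 1) +
        (if a ⬝ᵥ c + b < 0 then lt.queryOps c
         else if a ⬝ᵥ c + b = 0 then eq.queryOps c
         else gt.queryOps c)

end TernaryLDT

/-! ### Integer linear programs with a fixed feasible set and their normal fan -/

/-- The objective value `cᵀx`. -/
def objective {n : ℕ} (c : Fin n → ℝ) (x : Fin n → ℤ) : ℝ :=
  ∑ i, c i * (x i : ℝ)

/-- The cone `F(x)` of all cost vectors for which `x` is optimal over `X`. -/
def normalFanCone {n : ℕ} (X : Finset (Fin n → ℤ)) (x : Fin n → ℤ) : Set (Fin n → ℝ) :=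
  {c | ∀ y ∈ X, objective c y ≤ objective c x}

open Classical in
/-- The set `{x ∈ X | c ∈ F(x)}` of all optimal solutions for the cost vector `c`. -/
noncomputable def optimalSolutions {n : ℕ} (X : Finset (Fin n → ℤ)) (c : Fin n → ℝ) :
    Finset (Fin n → ℤ) :=
  X.filter (fun x => c ∈ normalFanCone X x)

/-- A policy is optimal if it maps every cost vector to an optimal solution. -/
def IsOptimalPolicy {n : ℕ} (X : Finset (Fin n → ℤ)) (π : (Fin n → ℝ) → X) : Prop :=
  ∀ c, (π c : Fin n → ℤ) ∈ optimalSolutions X c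

/-- Two distinct cones are adjacent if their intersection has positive dimension; the dimension
of a convex set is that of its affine hull. -/
def AdjacentCones {n : ℕ} (X : Finset (Fin n → ℤ)) (x y : Fin n → ℤ) : Prop :=
  x ≠ y ∧ 0 < Module.finrank ℝ (vectorSpan ℝ (normalFanCone X x ∩ normalFanCone X y))

open Classical in
/-- The pairs `(x, y) ∈ X × X` that define a divider `c ↦ (x - y)ᵀc`. -/
noncomputable def dividerPairs {n : ℕ} (X : Finset (Fin n → ℤ)) :
    Finset ((Fin n → ℤ) × (Fin n → ℤ)) :=
  (X ×ˢ X).filter (fun p => AdjacentCones X p.1 p.2)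

open Classical in
/-- `M`, the maximum of `‖x - y‖_∞` over all dividers (the norm of `Fin n → ℤ` is the maximum
norm); `M = 1` if there is no divider. -/
noncomputable def maxDividerNorm {n : ℕ} (X : Finset (Fin n → ℤ)) : ℝ :=
  if h : (dividerPairs X).Nonempty then (dividerPairs X).sup' h (fun p => ‖p.1 - p.2‖) else 1

/-- The number of bits of the binary encoding of an integer vector: one sign bit and the binary
digits of the absolute value, for every entry. -/
def bitSize {n : ℕ} (x : Fin n → ℤ) : ℕ :=
  ∑ i, (1 + (x i).natAbs.size)

/-- The feasible set is binary, `X ⊆ {0,1}ⁿ`. -/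
def IsBinary {n : ℕ} (X : Finset (Fin n → ℤ)) : Prop :=
  ∀ x ∈ X, ∀ i, x i = 0 ∨ x i = 1

/-! The optimal set for `c` depends only on the signs of `aᵀc` for integral `a` with `‖a‖_∞ ≤ M`
(`optimalSolutions_subset_of_sign_eq`): on the segment between two cost vectors with different
optimal sets, the first `y` to overtake `x` does so at a nonzero point of both cones, so `y - x` is
a divider and changes sign.

All these signs are found together (`solvableLDT_signs_of_support`). With `W = max |c i| > 0`,
bisection approximates the ratios `c i / W`, and Dirichlet's theorem yields integers `q > 0`, `p`
with `q c = W p + r`, where `r` is so small that `aᵀp ≠ 0` decides the sign of `aᵀc`. If `aᵀp = 0`,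
the sign is that of `aᵀr`. The remainder `r` is linear in `c` on each branch and vanishes at the
maximal coordinate, so `n` rounds suffice. A round costs `2n + 1 + n(n+1)s` tests with `s =
⌈log₂(2nM)⌉`; this is even `O(n³ s)` in total. Only depth is counted: computing `q` and `p` from the
bisection results needs no test. -/

/-! ### Composition of linear decision trees -/

namespace TernaryLDT

variable {n : ℕ} {α β : Type}

/-- Replace every leaf of a tree by the tree attached to its output. -/
def bind : TernaryLDT n α → (α → TernaryLDT n β) → TernaryLDT n β
  | leaf out, f => f out
  | node a b lt eq gt, f => node a b (lt.bind f) (eq.bind f) (gt.bind f)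

theorem eval_bind (T : TernaryLDT n α) (f : α → TernaryLDT n β) (c : Fin n → ℝ) :
    (T.bind f).eval c = (f (T.eval c)).eval c := by
  induction T with
  | leaf out => rfl
  | node a b lt eq gt h₁ h₂ h₃ =>
    simp only [bind, eval]
    split_ifs <;> assumption

theorem depth_bind_le (T : TernaryLDT n α) (f : α → TernaryLDT n β) {d : ℕ}
    (hf : ∀ a, (f a).depth ≤ d) : (T.bind f).depth ≤ T.depth + d := by
  induction T with
  | leaf out => simpa [bind, depth] using hf out
  | node a b lt eq gt h₁ h₂ h₃ =>
    simp only [bind, depth]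
    omega

/-- Apply a function to all outputs of a tree. -/
def map (T : TernaryLDT n α) (g : α → β) : TernaryLDT n β :=
  T.bind fun a => leaf (g a)

theorem eval_map (T : TernaryLDT n α) (g : α → β) (c : Fin n → ℝ) :
    (T.map g).eval c = g (T.eval c) := by
  rw [map, eval_bind]; rfl

theorem depth_map_le (T : TernaryLDT n α) (g : α → β) : (T.map g).depth ≤ T.depth :=
  depth_bind_le T (d := 0) _ fun _ => le_rfl

theorem queryOps_le (T : TernaryLDT n α) (c : Fin n → ℝ) :
    T.queryOps c ≤ (2 * n + 1) * T.depth := by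
  induction T with
  | leaf out => simp [queryOps]
  | node a b lt eq gt h₁ h₂ h₃ =>
    have key : ∀ k, k ≤ max lt.depth (max eq.depth gt.depth) →
        (2 * n + 1) * k ≤ (2 * n + 1) * max lt.depth (max eq.depth gt.depth) :=
      fun k hk => Nat.mul_le_mul_left _ hk
    have k₁ := key lt.depth (by omega)
    have k₂ := key eq.depth (by omega)
    have k₃ := key gt.depth (by omega)
    simp only [queryOps, depth, Nat.mul_add]
    split_ifs <;> omega

end TernaryLDT

/-- Some linear decision tree of depth at most `d` finds, for every input from `S`, an output that
is related to the input by `R`. -/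
def SolvableLDT {n : ℕ} {α : Type} (S : Set (Fin n → ℝ)) (d : ℕ)
    (R : (Fin n → ℝ) → α → Prop) : Prop :=
  ∃ T : TernaryLDT n α, T.depth ≤ d ∧ ∀ c ∈ S, R c (T.eval c)

namespace SolvableLDT

variable {n : ℕ} {α β : Type} {S : Set (Fin n → ℝ)} {d e : ℕ}
  {R : (Fin n → ℝ) → α → Prop} {Q : (Fin n → ℝ) → β → Prop}

theorem const (a : α) (h : ∀ c ∈ S, R c a) : SolvableLDT S d R :=
  ⟨.leaf a, Nat.zero_le _, h⟩

/-- The second tree needs to work only on inputs for which `a` is a valid answer; thus the knowledge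
gained on a path is carried by the set `S`. -/
theorem bind (hR : SolvableLDT S d R) (hQ : ∀ a, SolvableLDT {c ∈ S | R c a} e Q) :
    SolvableLDT S (d + e) Q := by
  obtain ⟨T, hT, hTR⟩ := hR
  choose f hf hfQ using hQ
  refine ⟨T.bind f, (T.depth_bind_le f hf).trans (by omega), fun c hc => ?_⟩
  rw [TernaryLDT.eval_bind]
  exact hfQ _ c ⟨hc, hTR c hc⟩

/-- A single test finds the sign of a linear functional. -/
theorem sign (u : (Fin n → ℝ) →ₗ[ℝ] ℝ) :
    SolvableLDT S 1 fun c s => s = SignType.sign (u c) := by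
  refine ⟨.node (fun i => u (Pi.single i 1)) 0 (.leaf (-1)) (.leaf 0) (.leaf 1),
    by simp [TernaryLDT.depth], fun c _ => ?_⟩
  have hu : (fun i => u (Pi.single i 1)) ⬝ᵥ c + 0 = u c := by
    rw [add_zero, LinearMap.pi_apply_eq_sum_univ u c, dotProduct]
    refine Finset.sum_congr rfl fun i _ => ?_
    rw [smul_eq_mul, mul_comm]
    congr 2
    ext j
    simp [Pi.single_apply, eq_comm]
  simp only [TernaryLDT.eval, hu]
  split_ifs with h₁ h₂
  · exact (sign_neg h₁).symm
  · rw [h₂, sign_zero]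
  · exact (sign_pos (lt_of_le_of_ne (not_lt.mp h₁) (Ne.symm h₂))).symm

/-- Finitely many tasks can be performed one after the other. -/
theorem pi {ι : Type} [Fintype ι] [Nonempty α] {P : ι → (Fin n → ℝ) → α → Prop}
    (h : ∀ i, SolvableLDT S d (P i)) :
    SolvableLDT S (Fintype.card ι * d) fun c (o : ι → α) => ∀ i, P i c (o i) := by
  classical
  have key : ∀ t : Finset ι,
      SolvableLDT S (t.card * d) fun c (o : ι → α) => ∀ i ∈ t, P i c (o i) := by
    intro t
    induction t using Finset.induction_on with
    | empty => exact const (fun _ => Classical.arbitrary α) (by simp)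
    | insert i t hi ih =>
      rw [Finset.card_insert_of_notMem hi, Nat.add_mul, one_mul]
      refine ih.bind fun o => ?_
      obtain ⟨T, hT, hP⟩ := h i
      refine ⟨T.map (Function.update o i), (T.depth_map_le _).trans hT, fun c hc j hj => ?_⟩
      rw [TernaryLDT.eval_map]
      rcases Finset.mem_insert.mp hj with rfl | hj
      · simpa using hP c hc.1
      · have hji : j ≠ i := fun h => hi (h ▸ hj)
        simpa [Function.update_of_ne hji] using hc.2 j hj
  simpa using key Finset.univ

/-- The index of the largest of finitely many linear functionals. -/
theorem argmax {ι : Type} [Fintype ι] [Nonempty ι] (u : ι → (Fin n → ℝ) →ₗ[ℝ] ℝ) :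
    SolvableLDT S (Fintype.card ι) fun c j => ∀ i, u i c ≤ u j c := by
  classical
  have key : ∀ t : Finset ι, SolvableLDT S t.card fun c j => ∀ i ∈ t, u i c ≤ u j c := by
    intro t
    induction t using Finset.induction_on with
    | empty => exact const (Classical.arbitrary ι) (by simp)
    | insert i t hi ih =>
      rw [Finset.card_insert_of_notMem hi]
      refine ih.bind fun j => ?_
      refine (sign (u i - u j)).bind (e := 0) fun s => ?_
      by_cases hs : s = 1
      · refine const i ?_
        rintro c ⟨⟨-, hj⟩, hsc⟩ k hk
        have : 0 < (u i - u j) c := sign_eq_one_iff.mp (hsc.symm.trans hs)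
        simp only [LinearMap.sub_apply] at this
        rcases Finset.mem_insert.mp hk with rfl | hk
        · exact le_rfl
        · linarith [hj k hk]
      · refine const j ?_
        rintro c ⟨⟨-, hj⟩, hsc⟩ k hk
        have : ¬ 0 < (u i - u j) c := fun h => hs (hsc.trans (sign_pos h))
        simp only [LinearMap.sub_apply] at this
        rcases Finset.mem_insert.mp hk with rfl | hk
        · linarith
        · exact hj k hk
  simpa using key Finset.univ

/-- Bisection: `K` tests approximate the ratio `u c / w c` with error at most `2⁻ᴷ`. -/
theorem bisection (u w : (Fin n → ℝ) →ₗ[ℝ] ℝ) (h : ∀ c ∈ S, |u c| ≤ w c) (K : ℕ) :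
    SolvableLDT S K fun c (m : ℤ) => |2 ^ K * u c - m * w c| ≤ w c := by
  induction K with
  | zero => exact const 0 (by simpa using h)
  | succ K ih =>
    refine ih.bind fun m => ?_
    -- The ratio lies in an interval of radius `2⁻ᴷ` around `m / 2ᴷ`. The test compares it with this
    -- midpoint, without division; the halves have centres `(2m ∓ 1) / 2ᴷ⁺¹`.
    refine (sign ((2 : ℝ) ^ K • u - (m : ℝ) • w)).bind (e := 0) fun s => ?_
    by_cases hs : s = -1
    · refine const (2 * m - 1) ?_
      rintro c ⟨⟨-, hm⟩, hsc⟩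
      have : ((2 : ℝ) ^ K • u - (m : ℝ) • w) c < 0 := sign_eq_neg_one_iff.mp (hsc.symm.trans hs)
      simp only [LinearMap.sub_apply, LinearMap.smul_apply, smul_eq_mul] at this
      rw [abs_le] at hm ⊢
      push_cast
      rw [pow_succ]
      constructor <;> linarith
    · refine const (2 * m + 1) ?_
      rintro c ⟨⟨-, hm⟩, hsc⟩
      have : ¬ ((2 : ℝ) ^ K • u - (m : ℝ) • w) c < 0 := fun h => hs (hsc.trans (sign_neg h))
      simp only [LinearMap.sub_apply, LinearMap.smul_apply, smul_eq_mul] at this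
      rw [abs_le] at hm ⊢
      push_cast
      rw [pow_succ]
      constructor <;> linarith

end SolvableLDT

/-! ### Simultaneous Diophantine approximation -/

/-- Dirichlet's theorem on simultaneous approximation. -/
theorem exists_simultaneous_approximation {ι : Type*} [Fintype ι] (β : ι → ℝ) {N : ℕ}
    (hN : 0 < N) :
    ∃ q : ℕ, 0 < q ∧ q ≤ N ^ Fintype.card ι ∧
      ∃ p : ι → ℤ, ∀ i, |q * β i - p i| < 1 / N := by
  classical
  have hN' : (0 : ℝ) < N := by exact_mod_cast hN
  have hlt : ∀ x : ℝ, ⌊Int.fract x * N⌋₊ < N := fun x => by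
    rw [Nat.floor_lt (by positivity)]
    exact mul_lt_of_lt_one_left hN' (Int.fract_lt_one x)
  -- Pigeonhole: one more multiple of `β` than there are boxes of side `1 / N` in the unit cube.
  let f : Fin (N ^ Fintype.card ι + 1) → ι → Fin N :=
    fun q i => ⟨⌊Int.fract ((q : ℕ) * β i) * N⌋₊, hlt _⟩
  obtain ⟨a, b, hab, hf⟩ : ∃ a b, a ≠ b ∧ f a = f b :=
    Fintype.exists_ne_map_eq_of_card_lt f (by simp)
  wlog hlt' : a < b generalizing a b
  · exact this b a hab.symm hf.symm (lt_of_le_of_ne (not_lt.mp hlt') hab.symm)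
  have hab' : (a : ℕ) < b := hlt'
  refine ⟨b - a, by omega, by have := b.2; omega,
    fun i => ⌊((b : ℕ) : ℝ) * β i⌋ - ⌊((a : ℕ) : ℝ) * β i⌋, fun i => ?_⟩
  have hfi : ⌊Int.fract (((a : ℕ) : ℝ) * β i) * N⌋₊ = ⌊Int.fract (((b : ℕ) : ℝ) * β i) * N⌋₊ :=
    congrArg Fin.val (congrFun hf i)
  have ha₁ := Nat.floor_le (mul_nonneg (Int.fract_nonneg (((a : ℕ) : ℝ) * β i)) hN'.le)
  have ha₂ := Nat.lt_floor_add_one (Int.fract (((a : ℕ) : ℝ) * β i) * N)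
  have hb₁ := Nat.floor_le (mul_nonneg (Int.fract_nonneg (((b : ℕ) : ℝ) * β i)) hN'.le)
  have hb₂ := Nat.lt_floor_add_one (Int.fract (((b : ℕ) : ℝ) * β i) * N)
  rw [hfi] at ha₁ ha₂
  have heq : (((b : ℕ) - (a : ℕ) : ℕ) : ℝ) * β i -
      ((⌊((b : ℕ) : ℝ) * β i⌋ - ⌊((a : ℕ) : ℝ) * β i⌋ : ℤ) : ℝ) =
      Int.fract (((b : ℕ) : ℝ) * β i) - Int.fract (((a : ℕ) : ℝ) * β i) := by
    rw [Nat.cast_sub hab'.le]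
    simp only [Int.fract]
    push_cast
    ring
  rw [heq, lt_div_iff₀ hN', ← Nat.abs_cast N, ← abs_mul, abs_lt]
  constructor <;> linarith

/-- If `w` is bounded by `W`, then the ratios `w i / W`, known up to `2⁻ᴷ`, have a common rational
approximation that does not depend on `w`. -/
theorem exists_approximation_of_bisection {n : ℕ} (m : Fin n → ℤ) (s : ℕ) :
    ∃ q : ℕ, 0 < q ∧ ∃ p : Fin n → ℤ, ∀ (w : Fin n → ℝ) (W : ℝ), 0 < W →
      (∀ i, |2 ^ ((n + 1) * s) * w i - m i * W| ≤ W) →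
      ∀ i, |q * w i - p i * W| * 2 ^ s < 2 * W := by
  -- Since `q ≤ 2^(n s)`, the bisection error `2^(-(n+1)s)` grows to at most `2⁻ˢ` after
  -- multiplication by `q`; Dirichlet's error adds less than another `2⁻ˢ`.
  obtain ⟨q, hq, hqN, p, hp⟩ := exists_simultaneous_approximation
    (fun i => (m i : ℝ) / 2 ^ ((n + 1) * s)) (N := 2 ^ s) (by positivity)
  refine ⟨q, hq, p, fun w W hW hw i => ?_⟩
  have hq' : (q : ℝ) ≤ (2 ^ s) ^ n := by
    simpa using (show (q : ℝ) ≤ ((2 ^ s) ^ Fintype.card (Fin n) : ℕ) by exact_mod_cast hqN)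
  have hK : (2 : ℝ) ^ ((n + 1) * s) = (2 ^ s) ^ n * 2 ^ s := by rw [← pow_mul, ← pow_add]; ring
  specialize hp i
  specialize hw i
  set A : ℝ := 2 ^ ((n + 1) * s) with hA
  have hA0 : 0 < A := by positivity
  have hs0 : (0 : ℝ) < 2 ^ s := by positivity
  have h₁ : |q * (m i / A) - p i| * 2 ^ s < 1 := by
    rw [lt_div_iff₀ (by positivity)] at hp
    simpa using hp
  have h₂ : |q * (w i - m i / A * W)| * 2 ^ s ≤ W := by
    have : (q : ℝ) * (w i - m i / A * W) = q / A * (A * w i - m i * W) := by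
      field_simp
    rw [this, abs_mul, abs_of_nonneg (by positivity)]
    have hqA : (q : ℝ) / A * 2 ^ s ≤ 1 := by
      rw [div_mul_eq_mul_div, div_le_one hA0, hK]
      gcongr
    calc (q : ℝ) / A * |A * w i - m i * W| * 2 ^ s
        = (q : ℝ) / A * 2 ^ s * |A * w i - m i * W| := by ring
      _ ≤ 1 * W := by gcongr
      _ = W := one_mul W
  have h₃ : (q : ℝ) * w i - p i * W = q * (w i - m i / A * W) + (q * (m i / A) - p i) * W := by
    ring
  calc |q * w i - p i * W| * 2 ^ s
      ≤ (|q * (w i - m i / A * W)| + |q * (m i / A) - p i| * W) * 2 ^ s := by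
        rw [h₃]
        gcongr
        exact (abs_add_le _ _).trans_eq (by rw [abs_mul _ W, abs_of_pos hW])
    _ = |q * (w i - m i / A * W)| * 2 ^ s + |q * (m i / A) - p i| * 2 ^ s * W := by ring
    _ < W + 1 * W := add_lt_add_of_le_of_lt h₂ (by gcongr)
    _ = 2 * W := by ring

/-! ### The signs of all integer combinations with bounded coefficients -/

theorem sign_eq_of_dominant {x y : ℝ} (h : |y| < |x|) :
    SignType.sign (x + y) = SignType.sign x := by
  rcases lt_trichotomy x 0 with hx | hx | hx
  · rw [abs_of_neg hx, abs_lt] at h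
    rw [sign_neg hx, sign_neg (by linarith)]
  · simp only [hx, abs_zero] at h
    exact absurd h (not_lt.mpr (abs_nonneg y))
  · rw [abs_of_pos hx, abs_lt] at h
    rw [sign_pos hx, sign_pos (by linarith)]

/-- If `q w = W p + w'` with an integral vector `p` and a small remainder `w'`, then the sign of
`aᵀw` is the sign of `aᵀp` or, if this vanishes, the sign of `aᵀw'`. -/
theorem sign_objective_eq_of_approximation {n : ℕ} {M : ℝ} {s : ℕ} (hs : 2 * n * M ≤ 2 ^ s)
    {q : ℕ} (hq : 0 < q) {p : Fin n → ℤ} {w : Fin n → ℝ} {W : ℝ} (hW : 0 < W)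
    (hw : ∀ i, |q * w i - p i * W| * 2 ^ s < 2 * W)
    {a : Fin n → ℤ} (ha : ∀ i, |(a i : ℝ)| ≤ M) :
    SignType.sign (objective w a) =
      if ∑ i, p i * a i = 0 then SignType.sign (objective (fun i => q * w i - p i * W) a)
      else SignType.sign (∑ i, p i * a i) := by
  have hq' : (0 : ℝ) < q := by exact_mod_cast hq
  have hdec : q * objective w a =
      W * ((∑ i, p i * a i : ℤ) : ℝ) + objective (fun i => q * w i - p i * W) a := by
    simp only [objective]
    push_cast
    rw [Finset.mul_sum, Finset.mul_sum, ← Finset.sum_add_distrib]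
    exact Finset.sum_congr rfl fun i _ => by ring
  have hsq : SignType.sign (objective w a) = SignType.sign (q * objective w a) := by
    rw [sign_mul, sign_pos hq', one_mul]
  rw [hsq, hdec]
  split_ifs with h
  · simp [h]
  have hn : Nonempty (Fin n) := by
    by_contra hn
    rw [not_nonempty_iff] at hn
    exact h (by simp)
  -- Integrality separates the scales: the leading term is at least `W` in absolute value, the
  -- remainder is below `W`.
  have hint : (1 : ℝ) ≤ |((∑ i, p i * a i : ℤ) : ℝ)| := by
    exact_mod_cast Int.one_le_abs h
  have hs0 : (0 : ℝ) < 2 ^ s := by positivity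
  have hM : 0 ≤ M := (abs_nonneg _).trans (ha hn.some)
  have hrem : |objective (fun i => q * w i - p i * W) a| * 2 ^ s < W * 2 ^ s := by
    -- The strict estimate below needs `M > 0`.
    rcases hM.eq_or_lt with hM | hM
    · have : objective (fun i => q * w i - p i * W) a = 0 := by
        refine Finset.sum_eq_zero fun i _ => ?_
        have : (a i : ℝ) = 0 := abs_nonpos_iff.mp (hM ▸ ha i)
        rw [this, mul_zero]
      rw [this, abs_zero, zero_mul]
      positivity
    calc |objective (fun i => q * w i - p i * W) a| * 2 ^ s
        ≤ (∑ i, |q * w i - p i * W| * |(a i : ℝ)|) * 2 ^ s := by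
          gcongr
          refine (Finset.abs_sum_le_sum_abs _ _).trans_eq ?_
          exact Finset.sum_congr rfl fun i _ => abs_mul _ _
      _ ≤ (∑ i, |q * w i - p i * W| * M) * 2 ^ s := by
          gcongr with i
          exact ha i
      _ = ∑ i, (|q * w i - p i * W| * 2 ^ s) * M := by
          rw [Finset.sum_mul]
          exact Finset.sum_congr rfl fun i _ => by ring
      _ < ∑ _i : Fin n, (2 * W) * M := by
          refine Finset.sum_lt_sum_of_nonempty Finset.univ_nonempty fun i _ => ?_
          exact mul_lt_mul_of_pos_right (hw i) hM
      _ = W * (2 * n * M) := by simp; ring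
      _ ≤ W * 2 ^ s := by gcongr
  rw [sign_eq_of_dominant, sign_mul, sign_pos hW, one_mul]
  · rcases lt_or_gt_of_ne h with h' | h'
    · rw [sign_neg h', sign_neg (by exact_mod_cast h')]
    · rw [sign_pos h', sign_pos (by exact_mod_cast h')]
  · rw [abs_mul, abs_of_pos hW]
    have := lt_of_mul_lt_mul_right hrem hs0.le
    nlinarith

open Classical in
/-- One round of the search eliminates one coordinate of the residual vector `L c`. -/
theorem solvableLDT_signs_of_support {n : ℕ} (hn : 0 < n) {M : ℝ} {s : ℕ}
    (hs : 2 * n * M ≤ 2 ^ s) (hs₁ : 1 ≤ s) (k : ℕ) :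
    ∀ (S : Set (Fin n → ℝ)) (L : Fin n → (Fin n → ℝ) →ₗ[ℝ] ℝ) (I : Finset (Fin n)),
      I.card ≤ k → (∀ c ∈ S, ∀ i ∉ I, L i c = 0) →
      SolvableLDT S (k * (2 * n + 1 + n * ((n + 1) * s)))
        fun c (o : (Fin n → ℤ) → SignType) => ∀ a : Fin n → ℤ, (∀ i, |(a i : ℝ)| ≤ M) →
          o a = SignType.sign (objective (fun i => L i c) a) := by
  induction k with
  | zero =>
    intro S L I hI hL
    refine SolvableLDT.const (fun _ => 0) fun c hc a _ => ?_
    have hI' : I = ∅ := by simpa using hI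
    have : objective (fun i => L i c) a = 0 :=
      Finset.sum_eq_zero fun i _ => mul_eq_zero_of_left (hL c hc i (by simp [hI'])) _
    rw [this, sign_zero]
  | succ k ih =>
    intro S L I hI hL
    have : Nonempty (Fin n × Bool) := ⟨(⟨0, hn⟩, true)⟩
    -- Comparing the `2n` functionals `± L i` makes the maximum of `|L i c|` a fixed linear
    -- functional `u j` on each branch.
    let u : Fin n × Bool → (Fin n → ℝ) →ₗ[ℝ] ℝ := fun j => if j.2 then L j.1 else -L j.1
    have hdepth : (k + 1) * (2 * n + 1 + n * ((n + 1) * s)) =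
        Fintype.card (Fin n × Bool) + (1 + (Fintype.card (Fin n) * ((n + 1) * s) +
          k * (2 * n + 1 + n * ((n + 1) * s)))) := by
      simp only [Fintype.card_prod, Fintype.card_fin, Fintype.card_bool]
      ring
    rw [hdepth]
    refine (SolvableLDT.argmax u).bind fun j => (SolvableLDT.sign (u j)).bind fun t => ?_
    have hbound : ∀ c, (∀ i, u i c ≤ u j c) → ∀ i, |L i c| ≤ u j c := fun c hc i =>
      abs_le'.mpr ⟨by simpa [u] using hc (i, true), by simpa [u] using hc (i, false)⟩
    by_cases ht : t = 1
    swap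
    · refine SolvableLDT.const (fun _ => 0) ?_
      rintro c ⟨⟨hc, hj⟩, htc⟩ a -
      have h₀ : ¬ 0 < u j c := fun h => ht (htc.trans (sign_pos h))
      have : objective (fun i => L i c) a = 0 := Finset.sum_eq_zero fun i _ =>
        mul_eq_zero_of_left (abs_nonpos_iff.mp ((hbound c hj i).trans (not_lt.mp h₀))) _
      rw [this, sign_zero]
    refine (SolvableLDT.pi fun i => SolvableLDT.bisection (L i) (u j)
      (fun c hc => hbound c hc.1.2 i) ((n + 1) * s)).bind fun m => ?_
    obtain ⟨q, hq, p, hp⟩ := exists_approximation_of_bisection m s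
    set S' := {c ∈ {c ∈ {c ∈ S | ∀ i, u i c ≤ u j c} | t = SignType.sign (u j c)} |
      ∀ i, |2 ^ ((n + 1) * s) * L i c - m i * u j c| ≤ u j c} with hS'
    have hW : ∀ c ∈ S', 0 < u j c := fun c hc => sign_eq_one_iff.mp (hc.1.2.symm.trans ht)
    have happ : ∀ c ∈ S', ∀ i, |q * L i c - p i * u j c| * 2 ^ s < 2 * u j c :=
      fun c hc => hp (fun i => L i c) _ (hW c hc) hc.2
    -- On this branch `q` and `p` are constants, so the remainder is again linear in `c` and can be
    -- tested.
    let L' : Fin n → (Fin n → ℝ) →ₗ[ℝ] ℝ := fun i => (q : ℝ) • L i - (p i : ℝ) • u j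
    have hL'apply : ∀ i c, L' i c = q * L i c - p i * u j c := fun i c => by simp [L']
    have h2s : (2 : ℝ) ≤ 2 ^ s := by
      calc (2 : ℝ) = 2 ^ 1 := by norm_num
        _ ≤ 2 ^ s := pow_le_pow_right₀ (by norm_num) hs₁
    /- A remainder that is an integral multiple of the maximum vanishes. -/
    have hzero : ∀ c ∈ S', ∀ i, ∀ z : ℤ, L i c = z * u j c → L' i c = 0 := by
      intro c hc i z hz
      have h := happ c hc i
      have hWc := hW c hc
      have hfac : q * L i c - p i * u j c = ((q * z - p i : ℤ) : ℝ) * u j c := by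
        rw [hz]; push_cast; ring
      rw [hL'apply, hfac]
      rw [hfac, abs_mul, abs_of_pos hWc] at h
      have hlt : |((q * z - p i : ℤ) : ℝ)| < 1 := by
        by_contra hge
        rw [not_lt] at hge
        nlinarith [mul_le_mul hge h2s (by norm_num) (abs_nonneg _)]
      have : |(q * z - p i : ℤ)| < 1 := by exact_mod_cast hlt
      rw [Int.abs_lt_one_iff.mp this, Int.cast_zero, zero_mul]
    have hnext : SolvableLDT S' (k * (2 * n + 1 + n * ((n + 1) * s)))
        fun c (o : (Fin n → ℤ) → SignType) => ∀ a : Fin n → ℤ, (∀ i, |(a i : ℝ)| ≤ M) →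
          o a = SignType.sign (objective (fun i => L' i c) a) := by
      -- The maximal coordinate has ratio `± 1` and those outside `I` have ratio `0`, so `hzero`
      -- kills their remainders. A maximum outside `I` would be `0`, contradicting `hW`.
      by_cases hjI : j.1 ∈ I
      · refine ih S' L' (I.erase j.1) (by rw [Finset.card_erase_of_mem hjI]; omega) ?_
        intro c hc i hi
        by_cases hij : i = j.1
        · subst hij
          by_cases hj : j.2 = true
          · exact hzero c hc _ 1 (by simp [u, hj])
          · exact hzero c hc _ (-1) (by simp [u, hj])
        · have hiI : i ∉ I := fun h => hi (Finset.mem_erase.mpr ⟨hij, h⟩)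
          exact hzero c hc i 0 (by simpa using hL c hc.1.1.1 i hiI)
      · refine SolvableLDT.const (fun _ => 0) fun c hc => ?_
        have h₀ : u j c = 0 := by
          have := hL c hc.1.1.1 j.1 hjI
          by_cases hj : j.2 = true <;> simp [u, hj, this]
        exact absurd (hW c hc) (by rw [h₀]; exact lt_irrefl _)
    obtain ⟨T, hT, hTs⟩ := hnext
    refine ⟨T.map fun o a => if ∑ i, p i * a i = 0 then o a else SignType.sign (∑ i, p i * a i),
      (T.depth_map_le _).trans hT, fun c hc a ha => ?_⟩
    rw [TernaryLDT.eval_map, hTs c hc a ha,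
      sign_objective_eq_of_approximation hs hq (hW c hc) (happ c hc) ha]
    simp only [hL'apply]

/-- A tree of depth `O(n³ s)` finds the signs of `aᵀc` for all integral vectors `a` whose entries
are bounded by `2ˢ / (2 n)`. -/
theorem solvableLDT_signs {n : ℕ} (hn : 0 < n) {M : ℝ} {s : ℕ}
    (hs : 2 * n * M ≤ 2 ^ s) (hs₁ : 1 ≤ s) :
    SolvableLDT Set.univ (n * (2 * n + 1 + n * ((n + 1) * s)))
      fun c (o : (Fin n → ℤ) → SignType) => ∀ a : Fin n → ℤ, (∀ i, |(a i : ℝ)| ≤ M) →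
        o a = SignType.sign (objective c a) :=
  solvableLDT_signs_of_support hn hs hs₁ n Set.univ (fun i => LinearMap.proj i) Finset.univ
    (by simp) (by simp)

/-! ### The dividers determine the optimal solutions -/

section Dividers

variable {n : ℕ} {X : Finset (Fin n → ℤ)}

theorem mem_optimalSolutions {c : Fin n → ℝ} {x : Fin n → ℤ} :
    x ∈ optimalSolutions X c ↔ x ∈ X ∧ ∀ y ∈ X, objective c y ≤ objective c x := by
  classical
  exact Finset.mem_filter

theorem optimalSolutions_nonempty (hX : X.Nonempty) (c : Fin n → ℝ) :
    (optimalSolutions X c).Nonempty := by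
  obtain ⟨x, hx, h⟩ := X.exists_max_image (objective c) hX
  exact ⟨x, mem_optimalSolutions.mpr ⟨hx, h⟩⟩

theorem objective_sub (c : Fin n → ℝ) (x y : Fin n → ℤ) :
    objective c (x - y) = objective c x - objective c y := by
  simp [objective, mul_sub]

/-- All cones contain `0`, so one common nonzero vector already makes the span nontrivial. -/
theorem adjacentCones_of_mem {x y : Fin n → ℤ} (hxy : x ≠ y) {c : Fin n → ℝ} (hc : c ≠ 0)
    (hx : c ∈ normalFanCone X x) (hy : c ∈ normalFanCone X y) : AdjacentCones X x y := by
  refine ⟨hxy, ?_⟩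
  have h₀ : ∀ z, (0 : Fin n → ℝ) ∈ normalFanCone X z := fun z w _ => by simp [objective]
  have hmem : c ∈ vectorSpan ℝ (normalFanCone X x ∩ normalFanCone X y) := by
    simpa using vsub_mem_vectorSpan ℝ (s := normalFanCone X x ∩ normalFanCone X y)
      ⟨hx, hy⟩ ⟨h₀ x, h₀ y⟩
  have : Nontrivial (vectorSpan ℝ (normalFanCone X x ∩ normalFanCone X y)) :=
    ⟨⟨c, hmem⟩, 0, fun h => hc (congrArg Subtype.val h)⟩
  exact Module.finrank_pos

theorem one_le_norm_of_ne {x y : Fin n → ℤ} (h : x ≠ y) : 1 ≤ ‖x - y‖ := by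
  obtain ⟨i, hi⟩ := Function.ne_iff.mp h
  refine le_trans ?_ (norm_le_pi_norm (x - y) i)
  rw [Pi.sub_apply, Int.norm_eq_abs]
  exact_mod_cast Int.one_le_abs (sub_ne_zero.mpr hi)

theorem norm_le_maxDividerNorm {x y : Fin n → ℤ} (hx : x ∈ X) (hy : y ∈ X)
    (h : AdjacentCones X x y) : ‖x - y‖ ≤ maxDividerNorm X := by
  have hmem : (x, y) ∈ dividerPairs X := by simp [dividerPairs, hx, hy, h]
  rw [maxDividerNorm, dif_pos ⟨_, hmem⟩]
  exact Finset.le_sup' (fun p : (Fin n → ℤ) × (Fin n → ℤ) => ‖p.1 - p.2‖) hmem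

/-- Ensures that unit vectors are among the vectors whose signs are known, and that `log₂ M ≥ 0`. -/
theorem one_le_maxDividerNorm (X : Finset (Fin n → ℤ)) : 1 ≤ maxDividerNorm X := by
  by_cases h : (dividerPairs X).Nonempty
  · obtain ⟨⟨x, y⟩, hp⟩ := h
    simp only [dividerPairs, Finset.mem_filter, Finset.mem_product] at hp
    exact (one_le_norm_of_ne hp.2.1).trans (norm_le_maxDividerNorm hp.1.1 hp.1.2 hp.2)
  · rw [maxDividerNorm, dif_neg h]

theorem maxDividerNorm_le {B : ℝ} (hB : 1 ≤ B) (h : ∀ x ∈ X, ∀ y ∈ X, ‖x - y‖ ≤ B) :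
    maxDividerNorm X ≤ B := by
  rw [maxDividerNorm]
  split_ifs with hne
  · refine Finset.sup'_le _ _ fun p hp => ?_
    simp only [dividerPairs, Finset.mem_filter, Finset.mem_product] at hp
    exact h _ hp.1.1 _ hp.1.2
  · exact hB

theorem maxDividerNorm_eq_one_of_isBinary (hX : IsBinary X) : maxDividerNorm X = 1 := by
  refine le_antisymm (maxDividerNorm_le le_rfl fun x hx y hy => ?_) (one_le_maxDividerNorm X)
  refine (pi_norm_le_iff_of_nonneg zero_le_one).mpr fun i => ?_
  rcases hX x hx i with h | h <;> rcases hX y hy i with h' | h' <;> simp [h, h']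

/-- Cost vectors with the same signs on all integral vectors bounded by `maxDividerNorm X` have
the same optimal solutions. -/
theorem optimalSolutions_subset_of_sign_eq {c d : Fin n → ℝ}
    (h : ∀ a : Fin n → ℤ, (∀ i, |(a i : ℝ)| ≤ maxDividerNorm X) →
      SignType.sign (objective c a) = SignType.sign (objective d a)) :
    optimalSolutions X c ⊆ optimalSolutions X d := by
  classical
  intro x hx
  rw [mem_optimalSolutions] at hx ⊢
  obtain ⟨hxX, hxc⟩ := hx
  refine ⟨hxX, ?_⟩
  by_contra! hne
  let gain : (Fin n → ℝ) → (Fin n → ℤ) → ℝ := fun e y => objective e y - objective e x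
  have hgc : ∀ y ∈ X, gain c y ≤ 0 := fun y hy => sub_nonpos.mpr (hxc y hy)
  /- The first point of the segment from `c` to `d` where a better `y` overtakes `x`. -/
  let τ : (Fin n → ℤ) → ℝ := fun y => -gain c y / (gain d y - gain c y)
  obtain ⟨y₀, hy₀, hy₀d⟩ := hne
  obtain ⟨y, hy, hmin⟩ := (X.filter fun y => 0 < gain d y).exists_min_image τ
    ⟨y₀, Finset.mem_filter.mpr ⟨hy₀, sub_pos.mpr hy₀d⟩⟩
  obtain ⟨hyX, hyd⟩ := Finset.mem_filter.mp hy
  have hτ₀ : 0 ≤ τ y := div_nonneg (by linarith [hgc y hyX]) (by linarith [hgc y hyX])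
  have hτ₁ : τ y < 1 := by
    rw [div_lt_one (by linarith [hgc y hyX])]
    linarith
  set t := τ y with ht
  let e : Fin n → ℝ := fun i => (1 - t) * c i + t * d i
  have hobj : ∀ z, objective e z = (1 - t) * objective c z + t * objective d z := by
    intro z
    simp only [objective, Finset.mul_sum, ← Finset.sum_add_distrib]
    exact Finset.sum_congr rfl fun i _ => by simp only [e]; ring
  have hgain : ∀ z, gain e z = (1 - t) * gain c z + t * gain d z := by
    intro z
    simp only [gain, hobj]
    ring
  have hex : e ∈ normalFanCone X x := by
    intro z hz
    rw [← sub_nonpos]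
    change gain e z ≤ 0
    rw [hgain]
    by_cases hzd : 0 < gain d z
    · have hpos : 0 < gain d z - gain c z := by linarith [hgc z hz]
      have hle : t ≤ τ z := hmin z (Finset.mem_filter.mpr ⟨hz, hzd⟩)
      rw [le_div_iff₀ hpos] at hle
      linarith
    · nlinarith [hgc z hz]
  have hey₀ : gain e y = 0 := by
    have hpos : gain d y - gain c y ≠ 0 := by linarith [hgc y hyX]
    have : t * (gain d y - gain c y) = -gain c y := div_mul_cancel₀ _ hpos
    rw [hgain]
    linarith
  have hey : e ∈ normalFanCone X y := fun z hz => (hex z hz).trans (sub_eq_zero.mp hey₀).ge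
  have hyx : y ≠ x := by
    rintro rfl
    simp [gain] at hyd
  -- Adjacency needs a nonzero common point. By the unit vectors, `c` and `d` agree in sign
  -- coordinatewise, so `e = 0` with `t < 1` would force `d = 0`.
  have he : e ≠ 0 := by
    intro he
    have hc₀ : ∀ i, d i = 0 := by
      intro i
      have hi : SignType.sign (c i) = SignType.sign (d i) := by
        have hsingle : ∀ f : Fin n → ℝ, objective f (Pi.single i 1) = f i := fun f => by
          simp [objective, Pi.single_apply]
        have := h (Pi.single i 1) fun k => by
          refine le_trans ?_ (one_le_maxDividerNorm X)
          by_cases hk : k = i <;> simp [hk]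
        rwa [hsingle, hsingle] at this
      have hei : (1 - t) * c i + t * d i = 0 := congrFun he i
      have ht₁ : 0 < 1 - t := by linarith
      rcases lt_trichotomy (d i) 0 with hd | hd | hd
      · have hci : c i < 0 := sign_eq_neg_one_iff.mp (hi.trans (sign_neg hd))
        nlinarith [mul_pos ht₁ (neg_pos.mpr hci)]
      · exact hd
      · have hci : 0 < c i := sign_eq_one_iff.mp (hi.trans (sign_pos hd))
        nlinarith [mul_pos ht₁ hci]
    have : gain d y = 0 := by simp [gain, objective, hc₀]
    linarith
  have hnorm := norm_le_maxDividerNorm hyX hxX (adjacentCones_of_mem hyx he hey hex)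
  have hsign := h (y - x) fun i => by
    refine le_trans ?_ hnorm
    rw [← Int.norm_eq_abs]
    exact norm_le_pi_norm (y - x) i
  rw [objective_sub, objective_sub, sign_pos (show 0 < objective d y - objective d x from hyd),
    sign_eq_one_iff] at hsign
  have := hgc y hyX
  simp only [gain] at this
  linarith

theorem optimalSolutions_eq_of_sign_eq {c d : Fin n → ℝ}
    (h : ∀ a : Fin n → ℤ, (∀ i, |(a i : ℝ)| ≤ maxDividerNorm X) →
      SignType.sign (objective c a) = SignType.sign (objective d a)) :
    optimalSolutions X c = optimalSolutions X d :=
  (optimalSolutions_subset_of_sign_eq h).antisymm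
    (optimalSolutions_subset_of_sign_eq fun a ha => (h a ha).symm)

theorem exists_tree_optimalSolutions {s : ℕ} (hn : 0 < n)
    (hs : 2 * n * maxDividerNorm X ≤ 2 ^ s) (hs₁ : 1 ≤ s) :
    ∃ T : TernaryLDT n (Finset (Fin n → ℤ)), (∀ c, T.eval c = optimalSolutions X c) ∧
      T.depth ≤ n * (2 * n + 1 + n * ((n + 1) * s)) := by
  classical
  obtain ⟨T, hT, hTs⟩ := solvableLDT_signs hn hs hs₁
  let P : ((Fin n → ℤ) → SignType) → (Fin n → ℝ) → Prop := fun o c =>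
    ∀ a : Fin n → ℤ, (∀ i, |(a i : ℝ)| ≤ maxDividerNorm X) → o a = SignType.sign (objective c a)
  -- Any cost vector realizing the signs at a leaf serves to label it; `∅` is used only for sign
  -- patterns that no cost vector realizes.
  refine ⟨T.map fun o => if h : ∃ c, P o c then optimalSolutions X h.choose else ∅, fun c => ?_,
    (T.depth_map_le _).trans hT⟩
  have hP : P (T.eval c) c := hTs c (Set.mem_univ c)
  have hex : ∃ d, P (T.eval c) d := ⟨c, hP⟩
  rw [TernaryLDT.eval_map, dif_pos hex]
  exact optimalSolutions_eq_of_sign_eq fun a ha =>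
    (hex.choose_spec a ha).symm.trans (hP a ha)

/-- A tree of depth at most `2 n⁴ log₂ n + 2 n⁴ log₂ M + 7 n³` for the optimal solutions. -/
theorem exists_tree_optimalSolutions_depth_le (hn : 1 ≤ n) (X : Finset (Fin n → ℤ)) :
    ∃ T : TernaryLDT n (Finset (Fin n → ℤ)), (∀ c, T.eval c = optimalSolutions X c) ∧
      (T.depth : ℝ) ≤ 2 * (n : ℝ) ^ 4 * Real.logb 2 n
        + 2 * (n : ℝ) ^ 4 * Real.logb 2 (maxDividerNorm X) + 7 * (n : ℝ) ^ 3 := by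
  have hn' : (1 : ℝ) ≤ n := by exact_mod_cast hn
  have hM := one_le_maxDividerNorm X
  set M := maxDividerNorm X with hMdef
  have hpos : 0 < 2 * n * M := by positivity
  have hlog : Real.logb 2 (2 * n * M) = 1 + Real.logb 2 n + Real.logb 2 M := by
    rw [Real.logb_mul (by positivity) (by positivity), Real.logb_mul (by norm_num) (by positivity),
      Real.logb_self_eq_one (by norm_num)]
  have hℓn : 0 ≤ Real.logb 2 n := Real.logb_nonneg (by norm_num) hn'
  have hℓM : 0 ≤ Real.logb 2 M := Real.logb_nonneg (by norm_num) hM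
  have hs : 2 * n * M ≤ 2 ^ ⌈Real.logb 2 (2 * n * M)⌉₊ := by
    rw [← Real.rpow_natCast, ← Real.logb_le_iff_le_rpow (by norm_num) hpos]
    exact Nat.le_ceil _
  have hs₁ : 1 ≤ ⌈Real.logb 2 (2 * n * M)⌉₊ := by
    rw [Nat.one_le_ceil_iff, hlog]
    linarith
  obtain ⟨T, hT, hdepth⟩ := exists_tree_optimalSolutions hn hs hs₁
  refine ⟨T, hT, (Nat.cast_le.mpr hdepth).trans ?_⟩
  have hceil := (Nat.ceil_lt_add_one (a := Real.logb 2 (2 * n * M)) (by rw [hlog]; linarith)).le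
  generalize ⌈Real.logb 2 (2 * n * M)⌉₊ = s at hceil
  rw [hlog] at hceil
  push_cast
  have h₂₃ : (n : ℝ) ^ 2 ≤ n ^ 3 := pow_le_pow_right₀ hn' (by norm_num)
  have h₁₂ : (n : ℝ) ≤ n ^ 3 := le_self_pow₀ hn' (by norm_num)
  have h₃₄ : (n : ℝ) ^ 3 ≤ n ^ 4 := pow_le_pow_right₀ hn' (by norm_num)
  -- The constant is `7 = 3 + 2 · 2`: one extra unit in `s` comes from the factor `2` in `2nM`, one
  -- from the ceiling. Only the last estimate weakens `n³` to `n⁴`.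
  calc (n : ℝ) * (2 * n + 1 + n * ((n + 1) * s))
      = 2 * n ^ 2 + n + (n ^ 3 + n ^ 2) * s := by ring
    _ ≤ 2 * n ^ 3 + n ^ 3 +
        (n ^ 3 + n ^ 3) * (1 + Real.logb 2 n + Real.logb 2 M + 1) := by gcongr
    _ = 2 * n ^ 3 * (Real.logb 2 n + Real.logb 2 M) + 7 * n ^ 3 := by ring
    _ ≤ 2 * n ^ 4 * (Real.logb 2 n + Real.logb 2 M) + 7 * n ^ 3 := by gcongr
    _ = _ := by ring

/-- Choosing an optimal solution at every leaf turns a tree for the sets of optimal solutions into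
an optimal policy. -/
theorem exists_policy_of_tree (hX : X.Nonempty) (T : TernaryLDT n (Finset (Fin n → ℤ)))
    (hT : ∀ c, T.eval c = optimalSolutions X c) :
    ∃ π : (Fin n → ℝ) → X, IsOptimalPolicy X π ∧ ∃ T' : TernaryLDT n X,
      (∀ c, T'.eval c = π c) ∧ ∀ c, T'.queryOps c ≤ (2 * n + 1) * T.depth := by
  classical
  obtain ⟨x₀, hx₀⟩ := hX
  let g : Finset (Fin n → ℤ) → X := fun Y => if h : ∃ x : X, (x : Fin n → ℤ) ∈ Y
    then h.choose else ⟨x₀, hx₀⟩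
  refine ⟨fun c => g (optimalSolutions X c), fun c => ?_, T.map g, fun c => ?_, fun c => ?_⟩
  · obtain ⟨x, hx⟩ := optimalSolutions_nonempty ⟨x₀, hx₀⟩ c
    have hex : ∃ x : X, (x : Fin n → ℤ) ∈ optimalSolutions X c :=
      ⟨⟨x, (mem_optimalSolutions.mp hx).1⟩, hx⟩
    simp only [g, dif_pos hex]
    exact hex.choose_spec
  · rw [TernaryLDT.eval_map, hT]
  · exact ((T.map g).queryOps_le c).trans (Nat.mul_le_mul_left _ (T.depth_map_le g))

theorem maxDividerNorm_le_of_bitSize {k : ℕ} (h : ∀ x ∈ X, bitSize x ≤ k) :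
    maxDividerNorm X ≤ 2 ^ (k + 1) := by
  have hentry : ∀ x ∈ X, ∀ i, ‖x i‖ ≤ 2 ^ k := by
    intro x hx i
    have h₁ : (x i).natAbs.size ≤ bitSize x :=
      (Nat.le_add_left _ 1).trans (Finset.single_le_sum
        (f := fun i => 1 + (x i).natAbs.size) (fun _ _ => Nat.zero_le _) (Finset.mem_univ i))
    have h₂ : (x i).natAbs ≤ 2 ^ k :=
      (Nat.lt_size_self _).le.trans (Nat.pow_le_pow_right (by norm_num) (h₁.trans (h x hx)))
    rw [Int.norm_eq_abs, ← Int.cast_abs, Int.abs_eq_natAbs]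
    exact_mod_cast h₂
  refine maxDividerNorm_le (one_le_pow₀ (by norm_num)) fun x hx y hy => ?_
  refine (pi_norm_le_iff_of_nonneg (by positivity)).mpr fun i => ?_
  calc ‖(x - y) i‖ ≤ ‖x i‖ + ‖y i‖ := norm_sub_le _ _
    _ ≤ 2 ^ k + 2 ^ k := add_le_add (hentry x hx i) (hentry y hy i)
    _ = 2 ^ (k + 1) := by ring

theorem bitSize_le_of_isBinary (hX : IsBinary X) {x : Fin n → ℤ} (hx : x ∈ X) :
    bitSize x ≤ 2 * n := by
  calc bitSize x ≤ ∑ _i : Fin n, 2 := Finset.sum_le_sum fun i _ => by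
        rcases hX x hx i with h | h <;> simp [h]
    _ = 2 * n := by simp [mul_comm]

end Dividers

/-! ### Operation counts and the main theorem -/

theorem exists_polynomial_policy (p : Polynomial ℕ) : ∃ q : Polynomial ℕ,
    ∀ n : ℕ, 1 ≤ n → ∀ X : Finset (Fin n → ℤ), X.Nonempty →
      (∀ x ∈ X, bitSize x ≤ p.eval n) →
      ∃ π : (Fin n → ℝ) → X, IsOptimalPolicy X π ∧
        ∃ T : TernaryLDT n X, (∀ c, T.eval c = π c) ∧ (∀ c, T.queryOps c ≤ q.eval n) := by
  -- Operations per test times the depth bound, with `log₂ n ≤ n` and `log₂ M ≤ p(n) + 1`.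
  refine ⟨(2 * Polynomial.X + 1) * (2 * Polynomial.X ^ 4 * Polynomial.X +
    2 * Polynomial.X ^ 4 * (p + 1) + 7 * Polynomial.X ^ 3), fun n hn X hX hbits => ?_⟩
  obtain ⟨T, hT, hdepth⟩ := exists_tree_optimalSolutions_depth_le hn X
  obtain ⟨π, hπ, T', hT', hops⟩ := exists_policy_of_tree hX T hT
  refine ⟨π, hπ, T', hT', fun c => (hops c).trans ?_⟩
  have hn' : (0 : ℝ) < n := by exact_mod_cast hn
  have hM := one_le_maxDividerNorm X
  have hlogM : Real.logb 2 (maxDividerNorm X) ≤ (p.eval n : ℕ) + 1 := by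
    rw [Real.logb_le_iff_le_rpow (by norm_num) (by linarith)]
    exact_mod_cast maxDividerNorm_le_of_bitSize hbits
  have hlogn : Real.logb 2 n ≤ n := by
    rw [Real.logb_le_iff_le_rpow (by norm_num) hn', Real.rpow_natCast]
    exact_mod_cast Nat.lt_two_pow_self.le
  have key : (T.depth : ℝ) ≤ 2 * (n : ℝ) ^ 4 * n + 2 * (n : ℝ) ^ 4 * ((p.eval n : ℕ) + 1)
      + 7 * (n : ℝ) ^ 3 := hdepth.trans (by gcongr)
  have key' : T.depth ≤ 2 * n ^ 4 * n + 2 * n ^ 4 * (p.eval n + 1) + 7 * n ^ 3 := by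
    exact_mod_cast key
  simpa using Nat.mul_le_mul_left (2 * n + 1) key'

theorem mainTheorem1 :
    -- the optimal solutions are computed by a ternary tree of the stated depth
    (∃ C : ℝ, ∀ n : ℕ, 1 ≤ n → ∀ X : Finset (Fin n → ℤ), X.Nonempty →
      ∃ T : TernaryLDT n (Finset (Fin n → ℤ)),
        (∀ c, T.eval c = optimalSolutions X c) ∧
        (T.depth : ℝ) ≤ 2 * (n : ℝ) ^ 4 * Real.logb 2 n
          + 2 * (n : ℝ) ^ 4 * Real.logb 2 (maxDividerNorm X) + C * (n : ℝ) ^ 3) ∧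
    -- polynomial bit size: an optimal policy with polynomially many operations per query
    (∀ p : Polynomial ℕ, ∃ q : Polynomial ℕ,
      ∀ n : ℕ, 1 ≤ n → ∀ X : Finset (Fin n → ℤ), X.Nonempty →
        (∀ x ∈ X, bitSize x ≤ p.eval n) →
        ∃ π : (Fin n → ℝ) → X, IsOptimalPolicy X π ∧
          ∃ T : TernaryLDT n X, (∀ c, T.eval c = π c) ∧ (∀ c, T.queryOps c ≤ q.eval n)) ∧
    -- binary feasible sets
    (∀ n : ℕ, 1 ≤ n → ∀ X : Finset (Fin n → ℤ), X.Nonempty → IsBinary X →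
      maxDividerNorm X = 1) ∧
    (∃ C : ℝ, ∀ n : ℕ, 1 ≤ n → ∀ X : Finset (Fin n → ℤ), X.Nonempty → IsBinary X →
      ∃ T : TernaryLDT n (Finset (Fin n → ℤ)),
        (∀ c, T.eval c = optimalSolutions X c) ∧
        (T.depth : ℝ) ≤ 2 * (n : ℝ) ^ 4 * Real.logb 2 n + C * (n : ℝ) ^ 3) ∧
    (∃ q : Polynomial ℕ,
      ∀ n : ℕ, 1 ≤ n → ∀ X : Finset (Fin n → ℤ), X.Nonempty → IsBinary X →
        ∃ π : (Fin n → ℝ) → X, IsOptimalPolicy X π ∧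
          ∃ T : TernaryLDT n X, (∀ c, T.eval c = π c) ∧ (∀ c, T.queryOps c ≤ q.eval n)) := by
  refine ⟨⟨7, fun n hn X _ => exists_tree_optimalSolutions_depth_le hn X⟩,
    exists_polynomial_policy, fun n _ X _ hX => maxDividerNorm_eq_one_of_isBinary hX,
    ⟨7, fun n hn X _ hX => ?_⟩, ?_⟩
  · obtain ⟨T, hT, hdepth⟩ := exists_tree_optimalSolutions_depth_le hn X
    exact ⟨T, hT, by simpa [maxDividerNorm_eq_one_of_isBinary hX] using hdepth⟩
  -- A binary entry takes a sign bit and at most one digit.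
  · obtain ⟨q, hq⟩ := exists_polynomial_policy (2 * Polynomial.X)
    exact ⟨q, fun n hn X hX hbin => hq n hn X hX fun x hx => by
      simpa using bitSize_le_of_isBinary hbin hx⟩
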